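/- Let $(f_n)_{n\ge 1}$ be a sequence of complex polynomials such that $\lim_{n\to\infty} f_n^{(k)}(0)$ exists for every integer $k\ge 0$ and $\lim_{n\to\infty} f_n(0)\neq 0$. Suppose that for every $n$ all the zeros of $f_n$ lie in the closed right half plane $\{z\in\mathbb{C}:\operatorname{Re} z\ge 0\}$ (this condition is regarded as satisfied if $f_n$ is the zero polynomial). Then $(f_n)$ converges, uniformly on compact subsets of $\mathbb{C}$, to an entire function $f$ of the form $$f(z)=f(0)\,e^{\alpha z^2-\beta z}\prod_j\left(1-\frac{z}{a_j}\right)e^{z/a_j}\qquad(z\in\mathbb{C}),$$ where $\alpha,\beta$ are complex constants and $(a_j)$ is a finite (possibly empty) or countably infinite family of nonzero complex numbers with $\operatorname{Re} a_j\ge 0$ for all $j$ and $\sum_j |a_j|^{-2}<\infty$. Furthermore, $\sum_j \operatorname{Re}(1/a_j)$ converges with $$\sum_j \operatorname{Re}(1/a_j)\le \operatorname{Re}\beta,$$ and $\alpha$ is real with $\alpha\ge 0$. -/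

import Mathlib

open Filter Topology

namespace PolySeq

/-- A sequence of polynomials converges weakly if, for every `k`, the sequence of the `k`-th
derivatives at `0` converges. -/
def WeaklyConvergent (f : ℕ → Polynomial ℂ) : Prop :=
  ∀ k : ℕ, ∃ c : ℂ, Tendsto (fun n => ((Polynomial.derivative^[k]) (f n)).eval 0) atTop (𝓝 c)

/-- A sequence of functions on `ℂ` converges strongly to `g` if it converges to `g` uniformly on
every compact subset of `ℂ`. -/
def StronglyConvergesTo (F : ℕ → ℂ → ℂ) (g : ℂ → ℂ) : Prop :=
  ∀ K : Set ℂ, IsCompact K → TendstoUniformlyOn F g atTop K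

/-- The zero set of a polynomial; by convention it is empty for the zero polynomial. -/
def zeroSet (p : Polynomial ℂ) : Set ℂ := {z | p ≠ 0 ∧ p.eval z = 0}

/-- The closed right half plane. -/
def rightHalfPlane : Set ℂ := {z | 0 ≤ z.re}

end PolySeq

/-! Once `f n` is nonzero at `0`, write `f n = f n (0) * ∏ (1 - x n j * z)` with reciprocal zeros `x
n j` of nonnegative real part. The coefficients of degree at most 2 determine `∑ x` and `∑ x ^ 2`,
which therefore converge, to `s₁` and `s₂`. Since `|w|² = 2 (Re w)² - Re (w²)` and `∑ (Re x)² ≤ (∑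
Re x)²`, the sums `∑ |x|²` stay bounded (`sum_norm_sq_le`). This bounds `f n` on discs, and
coefficientwise convergence becomes locally uniform convergence.

To identify the limit, order the `x n j` by decreasing modulus, so that `|x n j| ≤ √(C/(j+1))`, and
pass to a subsequence with `x n j → y j`. Genus-two factors differ from 1 by `O(|u|³)`, so their
product passes to the limit by domination; the exponential split off tends to `exp (-s₁ z - s₂
z²/2)`. Returning to genus one gives `β = s₁` and `2α = ∑ y² - s₂`. Fatou gives `∑ Re y ≤ Re s₁`. In
the second power sum only `(Im x)²` can lose mass, whence `α` is real and nonnegative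
(`power_sums_of_tendsto`). -/

namespace PolySeq

/-! ### Factorization over reciprocal zeros, and the low coefficients -/

/-- A polynomial not vanishing at `0`, with all zeros in the closed right half plane, is a multiple
of `∏ (1 - x j X)`, where the `x j` have nonnegative real part and decreasing modulus. -/
theorem exists_antitone_factorization (p : Polynomial ℂ) (hp : p.eval 0 ≠ 0)
    (hz : zeroSet p ⊆ rightHalfPlane) :
    ∃ (x : ℕ → ℂ) (m : ℕ), (∀ j, m ≤ j → x j = 0) ∧ Antitone (fun j => ‖x j‖) ∧
      (∀ j, 0 ≤ (x j).re) ∧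
      p = Polynomial.C (p.eval 0) *
        ∏ j ∈ Finset.range m, (1 - Polynomial.C (x j) * Polynomial.X) := by
  have hp0 : p ≠ 0 := by rintro rfl; simp at hp
  let r : ℂ → ℂ → Prop := fun a b => ‖b‖ ≤ ‖a‖
  have : Std.Total r := ⟨fun a b => le_total _ _⟩
  have : IsTrans ℂ r := ⟨fun a b c h1 h2 => le_trans h2 h1⟩
  classical
  let l : List ℂ := (p.roots.map (·⁻¹)).toList.insertionSort r
  have hl : (l : Multiset ℂ) = p.roots.map (·⁻¹) := by
    rw [← Multiset.coe_toList (p.roots.map (·⁻¹))]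
    exact Multiset.coe_eq_coe.2 (List.perm_insertionSort r _)
  have hsort : l.Pairwise r := List.pairwise_insertionSort r _
  have hre : ∀ y ∈ l, 0 ≤ y.re := by
    intro y hy
    rw [← Multiset.mem_coe, hl, Multiset.mem_map] at hy
    obtain ⟨a, ha, rfl⟩ := hy
    have h1 : a ∈ rightHalfPlane := hz ⟨hp0, (Polynomial.mem_roots hp0).1 ha⟩
    rw [Complex.inv_re]
    exact div_nonneg h1 (Complex.normSq_nonneg _)
  -- Padding by `0` contributes factors 1 and keeps the moduli decreasing.
  refine ⟨fun j => l.getD j 0, l.length, fun j hj => List.getD_eq_default _ _ hj, ?_, ?_, ?_⟩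
  · intro i j hij
    rcases hij.eq_or_lt with rfl | hij
    · exact le_rfl
    dsimp only
    by_cases hj : j < l.length
    · rw [List.getD_eq_getElem _ _ hj, List.getD_eq_getElem _ _ (hij.trans hj)]
      exact List.pairwise_iff_getElem.1 hsort i j (hij.trans hj) hj hij
    · rw [List.getD_eq_default _ _ (not_lt.1 hj)]
      simp
  · intro j
    by_cases hj : j < l.length
    · dsimp only
      rw [List.getD_eq_getElem _ _ hj]
      exact hre _ (List.getElem_mem hj)
    · dsimp only
      rw [List.getD_eq_default _ _ (not_lt.1 hj)]
      simp
  · have h1 : ∏ j ∈ Finset.range l.length,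
        (1 - Polynomial.C (l.getD j 0) * Polynomial.X : Polynomial ℂ) =
        (p.roots.map fun a => (1 - Polynomial.C a⁻¹ * Polynomial.X : Polynomial ℂ)).prod := by
      rw [show (p.roots.map fun a => (1 - Polynomial.C a⁻¹ * Polynomial.X : Polynomial ℂ)) =
        (p.roots.map (·⁻¹)).map fun a => (1 - Polynomial.C a * Polynomial.X : Polynomial ℂ) by
          rw [Multiset.map_map]; rfl, ← hl, Multiset.map_coe, Multiset.prod_coe,
        Finset.prod_range]
      rw [← List.prod_ofFn]
      congr 1
      apply List.ext_getElem <;> simp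
    have h2 := (IsAlgClosed.splits p).eq_prod_roots
    have h3 : (p.roots.map fun a => Polynomial.X - Polynomial.C a).prod =
        Polynomial.C (p.roots.map fun a => -a).prod *
        (p.roots.map fun a => (1 - Polynomial.C a⁻¹ * Polynomial.X : Polynomial ℂ)).prod := by
      rw [map_multiset_prod, Multiset.map_map, ← Multiset.prod_map_mul]
      congr 1
      refine Multiset.map_congr rfl fun a ha => ?_
      have ha0 : a ≠ 0 := by
        rintro rfl
        exact hp ((Polynomial.mem_roots hp0).1 ha)
      have : Polynomial.C a * Polynomial.C a⁻¹ = (1 : Polynomial ℂ) := by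
        rw [← Polynomial.C_mul, mul_inv_cancel₀ ha0, Polynomial.C_1]
      simp only [Function.comp, Polynomial.C_neg]
      linear_combination -Polynomial.X * this
    have h4 : p.eval 0 = p.leadingCoeff * (p.roots.map fun a => -a).prod := by
      conv_lhs => rw [h2]
      rw [Polynomial.eval_mul, Polynomial.eval_C, Polynomial.eval_multiset_prod,
        Multiset.map_map]
      simp
    rw [h1, h4, Polynomial.C_mul, mul_assoc, ← h3]
    exact h2

theorem coeff_zero_prod_one_sub (x : ℕ → ℂ) (m : ℕ) :
    (∏ j ∈ Finset.range m, (1 - Polynomial.C (x j) * Polynomial.X)).coeff 0 = 1 := by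
  rw [Polynomial.coeff_zero_eq_eval_zero, Polynomial.eval_prod]
  simp

theorem coeff_one_prod_one_sub (x : ℕ → ℂ) (m : ℕ) :
    (∏ j ∈ Finset.range m, (1 - Polynomial.C (x j) * Polynomial.X)).coeff 1 =
      -∑ j ∈ Finset.range m, x j := by
  induction m with
  | zero => simp [Polynomial.coeff_one]
  | succ m ih =>
    rw [Finset.prod_range_succ, Finset.sum_range_succ, mul_sub, mul_one, Polynomial.coeff_sub, ih,
      mul_left_comm, Polynomial.coeff_C_mul, Polynomial.coeff_mul_X, coeff_zero_prod_one_sub]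
    ring

theorem coeff_two_prod_one_sub (x : ℕ → ℂ) (m : ℕ) :
    2 * (∏ j ∈ Finset.range m, (1 - Polynomial.C (x j) * Polynomial.X)).coeff 2 =
      (∑ j ∈ Finset.range m, x j) ^ 2 - ∑ j ∈ Finset.range m, x j ^ 2 := by
  induction m with
  | zero => simp [Polynomial.coeff_one]
  | succ m ih =>
    rw [Finset.prod_range_succ, Finset.sum_range_succ, Finset.sum_range_succ, mul_sub, mul_one,
      Polynomial.coeff_sub, mul_sub, ih, mul_left_comm, Polynomial.coeff_C_mul,
      Polynomial.coeff_mul_X, coeff_one_prod_one_sub]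
    ring

/-! ### From bounds on discs to locally uniform convergence -/

theorem norm_coeff_le_of_forall_norm_eval_le (p : Polynomial ℂ) {R B : ℝ} (hR : 0 < R)
    (h : ∀ z : ℂ, ‖z‖ ≤ R → ‖p.eval z‖ ≤ B) (k : ℕ) : ‖p.coeff k‖ ≤ B / R ^ k := by
  have h2 : ∀ k, iteratedDeriv k (fun z => p.eval z) =
      fun z => ((Polynomial.derivative^[k]) p).eval z := by
    intro k
    induction k with
    | zero => simp
    | succ k ih =>
      rw [iteratedDeriv_succ, ih, Function.iterate_succ_apply']
      ext z
      simp
  have h1 := Complex.norm_iteratedDeriv_le_of_forall_mem_sphere_norm_le (c := 0) (R := R) (C := B)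
    (f := fun z => p.eval z) k hR p.differentiable.diffContOnCl
    (fun z hz => h z (by simpa using (mem_sphere_zero_iff_norm.1 hz).le))
  simp only [h2 k, ← Polynomial.coeff_zero_eq_eval_zero, Polynomial.coeff_iterate_derivative,
    zero_add, Nat.descFactorial_self, nsmul_eq_mul] at h1
  have hk : (0 : ℝ) < k.factorial := by positivity
  rw [norm_mul, Complex.norm_natCast, mul_div_assoc] at h1
  exact le_of_mul_le_mul_left h1 hk

/-- A sequence of polynomials with convergent coefficients which is bounded on every disc converges
uniformly on compact sets to an entire function. -/
theorem exists_stronglyConvergesTo (f : ℕ → Polynomial ℂ) (c : ℕ → ℂ)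
    (hc : ∀ k, Tendsto (fun n => (f n).coeff k) atTop (𝓝 (c k)))
    (hb : ∀ R : ℝ, ∃ B : ℝ, ∀ᶠ n in atTop, ∀ z : ℂ, ‖z‖ ≤ R → ‖(f n).eval z‖ ≤ B) :
    ∃ g : ℂ → ℂ, Differentiable ℂ g ∧ StronglyConvergesTo (fun n z => (f n).eval z) g := by
  have key : ∀ R : ℝ, 0 < R →
      TendstoUniformlyOn (fun n z => (f n).eval z) (fun z => ∑' k, c k * z ^ k) atTop
        (Metric.closedBall 0 R) := by
    intro R hR
    -- Cauchy estimates at radius `2 * R` make the terms on the disc of radius `R` at most `B / 2 ^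
    -- k`.
    obtain ⟨B, hB⟩ := hb (2 * R)
    have hn : ∀ᶠ n in atTop, ∀ k, ‖(f n).coeff k‖ ≤ B / (2 * R) ^ k := hB.mono fun n h k =>
      norm_coeff_le_of_forall_norm_eval_le _ (by positivity) h k
    have hcb : ∀ k, ‖c k‖ ≤ B / (2 * R) ^ k := fun k =>
      le_of_tendsto (hc k).norm (hn.mono fun n h => h k)
    have hRk : ∀ k, B / (2 * R) ^ k * R ^ k = B * (1 / 2) ^ k := by
      intro k
      rw [mul_pow, one_div, inv_pow]
      field_simp
    have hgeo : Summable fun k : ℕ => (1 / 2 : ℝ) ^ k := summable_geometric_two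
    have hcs : ∀ z : ℂ, ‖z‖ ≤ R → Summable fun k => c k * z ^ k := fun z hz =>
      Summable.of_norm_bounded (hgeo.mul_left B) fun k => by
        rw [norm_mul, norm_pow, ← hRk]
        gcongr
        · exact (norm_nonneg _).trans (hcb k)
        · exact hcb k
    have hfs : ∀ n, Summable fun k => ‖(f n).coeff k - c k‖ * R ^ k := by
      intro n
      have h1 : Summable fun k => ‖c k‖ * R ^ k :=
        Summable.of_nonneg_of_le (fun k => by positivity) (fun k => by
          rw [← hRk]; gcongr; exact hcb k) (hgeo.mul_left B)
      have h2 : Summable fun k => ‖(f n).coeff k‖ * R ^ k :=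
        summable_of_ne_finset_zero (s := (f n).support) fun k hk => by
          rw [Polynomial.notMem_support_iff.1 hk]; simp
      refine Summable.of_nonneg_of_le (fun k => by positivity) (fun k => ?_) (h2.add h1)
      rw [← add_mul]
      gcongr
      exact norm_sub_le _ _
    have hlim : Tendsto (fun n => ∑' k, ‖(f n).coeff k - c k‖ * R ^ k) atTop (𝓝 0) := by
      have := tendsto_tsum_of_dominated_convergence (𝓕 := atTop)
        (f := fun n k => ‖(f n).coeff k - c k‖ * R ^ k) (g := fun _ => (0 : ℝ))
        (hgeo.mul_left (2 * B)) (fun k => by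
          simpa using ((tendsto_iff_norm_sub_tendsto_zero.1 (hc k)).mul_const (R ^ k)))
        (hn.mono fun n h k => by
          rw [Real.norm_of_nonneg (by positivity), mul_assoc, ← hRk, ← mul_assoc]
          gcongr
          linarith [norm_sub_le ((f n).coeff k) (c k), h k, hcb k])
      simpa using this
    rw [Metric.tendstoUniformlyOn_iff]
    intro ε hε
    filter_upwards [hlim.eventually (gt_mem_nhds hε)] with n h z hz
    have hz : ‖z‖ ≤ R := by simpa using hz
    have h1 : HasSum (fun k => (f n).coeff k * z ^ k) ((f n).eval z) := by
      rw [Polynomial.eval_eq_sum]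
      exact hasSum_sum_of_ne_finset_zero fun k hk => by
        rw [Polynomial.notMem_support_iff.1 hk, zero_mul]
    rw [dist_comm, dist_eq_norm, ← (h1.sub (hcs z hz).hasSum).tsum_eq]
    refine lt_of_le_of_lt (tsum_of_norm_bounded (hfs n).hasSum fun k => ?_) h
    rw [← sub_mul, norm_mul, norm_pow]
    gcongr
  have hstrong : StronglyConvergesTo (fun n z => (f n).eval z) (fun z => ∑' k, c k * z ^ k) := by
    intro K hK
    obtain ⟨R, hR0, hR⟩ := hK.isBounded.subset_closedBall_lt 0 0
    exact (key R hR0).mono hR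
  refine ⟨_, ?_, hstrong⟩
  rw [← differentiableOn_univ]
  refine TendstoLocallyUniformlyOn.differentiableOn (φ := atTop)
    (F := fun n z => (f n).eval z) ?_ (Eventually.of_forall fun n =>
      (f n).differentiable.differentiableOn) isOpen_univ
  rw [tendstoLocallyUniformlyOn_iff_forall_isCompact isOpen_univ]
  exact fun K _ hK => hstrong K hK

/-! ### Limits of series -/

theorem norm_tsum_mul_sub_sum_range_le {a u : ℕ → ℝ} {M b : ℝ} (J : ℕ) (ha : ∀ j, 0 ≤ a j)
    (hs : Summable a) (hM : ∑' j, a j ≤ M) (hb : 0 ≤ b) (hu : ∀ j, J ≤ j → ‖u j‖ ≤ b) :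
    ‖∑' j, a j * u j - ∑ j ∈ Finset.range J, a j * u j‖ ≤ M * b := by
  have hb' : ∀ j, ‖a (j + J) * u (j + J)‖ ≤ a (j + J) * b := fun j => by
    rw [norm_mul, Real.norm_of_nonneg (ha _)]
    exact mul_le_mul_of_nonneg_left (hu _ (Nat.le_add_left _ _)) (ha _)
  have hsJ : Summable fun j => a (j + J) := (summable_nat_add_iff J).2 hs
  have hsu : Summable fun j => a j * u j :=
    (summable_nat_add_iff J).1 (Summable.of_norm_bounded (hsJ.mul_right b) hb')
  rw [← hsu.sum_add_tsum_nat_add J, add_sub_cancel_left]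
  refine (tsum_of_norm_bounded (hsJ.mul_right b).hasSum hb').trans ?_
  rw [tsum_mul_right]
  refine mul_le_mul_of_nonneg_right (le_trans ?_ hM) hb
  rw [← hs.sum_add_tsum_nat_add J]
  exact le_add_of_nonneg_left (Finset.sum_nonneg fun j _ => ha j)

/-- Fatou's lemma for series of nonnegative terms whose sums converge. -/
theorem summable_and_tsum_le_of_tendsto {a : ℕ → ℕ → ℝ} {a' : ℕ → ℝ} {S : ℝ}
    (ha : ∀ n j, 0 ≤ a n j) (hs : ∀ n, Summable (a n))
    (hS : Tendsto (fun n => ∑' j, a n j) atTop (𝓝 S))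
    (hlim : ∀ j, Tendsto (fun n => a n j) atTop (𝓝 (a' j))) :
    Summable a' ∧ ∑' j, a' j ≤ S := by
  have h0 : ∀ j, 0 ≤ a' j := fun j => ge_of_tendsto' (hlim j) fun n => ha n j
  have h1 : ∀ J, ∑ j ∈ Finset.range J, a' j ≤ S := fun J =>
    le_of_tendsto_of_tendsto' (tendsto_finsetSum _ fun j _ => hlim j) hS fun n =>
      (hs n).sum_le_tsum _ fun j _ => ha n j
  exact ⟨summable_of_sum_range_le h0 h1, Real.tsum_le_of_sum_range_le h0 h1⟩

/-- The `a n` need no common summable majorant: their total mass is at most `M`, and `b` is small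
beyond some `J`, so all tails are uniformly small. It is applied with `a` the real parts and `u` the
real or imaginary parts. -/
theorem tendsto_tsum_mul_of_bounded_of_tendsto_zero {a u : ℕ → ℕ → ℝ} {a' u' b : ℕ → ℝ} {M : ℝ}
    (ha : ∀ n j, 0 ≤ a n j) (hs : ∀ n, Summable (a n)) (hM : ∀ n, ∑' j, a n j ≤ M)
    (hu : ∀ n j, ‖u n j‖ ≤ b j) (hb : Tendsto b atTop (𝓝 0))
    (hs' : Summable a') (hM' : ∑' j, a' j ≤ M)
    (hal : ∀ j, Tendsto (fun n => a n j) atTop (𝓝 (a' j)))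
    (hul : ∀ j, Tendsto (fun n => u n j) atTop (𝓝 (u' j))) :
    Tendsto (fun n => ∑' j, a n j * u n j) atTop (𝓝 (∑' j, a' j * u' j)) := by
  have ha' : ∀ j, 0 ≤ a' j := fun j => ge_of_tendsto' (hal j) fun n => ha n j
  have hu' : ∀ j, ‖u' j‖ ≤ b j := fun j => le_of_tendsto' (hul j).norm fun n => hu n j
  have hM0 : 0 ≤ M := (tsum_nonneg ha').trans hM'
  rw [Metric.tendsto_atTop']
  intro ε hε
  obtain ⟨δ, hδ, hδε⟩ : ∃ δ > 0, M * δ + M * δ < ε / 2 := by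
    refine ⟨ε / (4 * M + 4) / 2, by positivity, ?_⟩
    have : (4 * M + 4) * (ε / (4 * M + 4)) = ε := by field_simp
    have h2 : 0 < ε / (4 * M + 4) := by positivity
    linarith
  obtain ⟨J, hJ⟩ := eventually_atTop.1 (hb.eventually (gt_mem_nhds hδ))
  have hfin : Tendsto (fun n => ∑ j ∈ Finset.range J, a n j * u n j) atTop
      (𝓝 (∑ j ∈ Finset.range J, a' j * u' j)) :=
    tendsto_finsetSum _ fun j _ => (hal j).mul (hul j)
  obtain ⟨N, hN⟩ := (Metric.tendsto_atTop.1 hfin) (ε / 2) (by positivity)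
  refine ⟨N, fun n hn => ?_⟩
  have h1 := norm_tsum_mul_sub_sum_range_le J (ha n) (hs n) (hM n) hδ.le
    (fun j hj => (hu n j).trans (hJ j hj).le)
  have h2 := norm_tsum_mul_sub_sum_range_le J ha' hs' hM' hδ.le
    (fun j hj => (hu' j).trans (hJ j hj).le)
  have h3 := hN n hn.le
  rw [Real.dist_eq] at h3 ⊢
  rw [Real.norm_eq_abs] at h1 h2
  rw [abs_le] at h1 h2
  rw [abs_lt] at h3 ⊢
  constructor <;> linarith [h1.1, h1.2, h2.1, h2.2, h3.1, h3.2]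

/-! ### Elementary factors -/

/-- The Weierstrass elementary factor of genus two. -/
noncomputable def elemFactorTwo (u : ℂ) : ℂ := (1 - u) * Complex.exp (u + u ^ 2 / 2)

theorem hasDerivAt_elemFactorTwo (u : ℂ) :
    HasDerivAt elemFactorTwo (-u ^ 2 * Complex.exp (u + u ^ 2 / 2)) u := by
  have h1 : HasDerivAt (fun u : ℂ => u + u ^ 2 / 2) (1 + u) u := by
    have := (hasDerivAt_id u).add (((hasDerivAt_id u).pow 2).div_const 2)
    refine this.congr_deriv ?_
    simp
  refine (((hasDerivAt_id u).const_sub 1).mul h1.cexp).congr_deriv ?_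
  simp only [id]
  ring

/-- The derivative has a double zero at `0`, so the mean value inequality yields a cube. -/
theorem norm_elemFactorTwo_sub_one_le {u : ℂ} {R : ℝ} (hu : ‖u‖ ≤ R) :
    ‖elemFactorTwo u - 1‖ ≤ Real.exp (R + R ^ 2 / 2) * ‖u‖ ^ 3 := by
  have h := (convex_closedBall (0 : ℂ) ‖u‖).norm_image_sub_le_of_norm_hasDerivWithin_le
    (f := elemFactorTwo) (C := ‖u‖ ^ 2 * Real.exp (R + R ^ 2 / 2)) (x := 0) (y := u)
    (fun w _ => (hasDerivAt_elemFactorTwo w).hasDerivWithinAt) (fun w hw => by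
      have hw : ‖w‖ ≤ ‖u‖ := by simpa using hw
      rw [norm_mul, norm_neg, norm_pow, Complex.norm_exp]
      gcongr
      refine (Complex.re_le_norm _).trans ((norm_add_le _ _).trans ?_)
      rw [norm_div, norm_pow, Complex.norm_ofNat]
      have := hw.trans hu
      gcongr) (by simp) (by simp)
  simp only [elemFactorTwo, sub_zero, zero_add, ne_eq, OfNat.ofNat_ne_zero, not_false_eq_true,
    zero_pow, zero_div, Complex.exp_zero, mul_one] at h ⊢
  calc _ ≤ _ := h
    _ = _ := by ring

/-- Here `|1 - u|² = 1 - 2 Re u + |u|² ≤ exp (-2 Re u + |u|²)`. -/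
theorem norm_one_sub_mul_exp_le (u : ℂ) :
    ‖(1 - u) * Complex.exp u‖ ≤ Real.exp (‖u‖ ^ 2 / 2) := by
  rw [norm_mul, Complex.norm_exp]
  have h1 : ‖1 - u‖ ≤ Real.exp (-u.re + ‖u‖ ^ 2 / 2) := by
    refine le_of_sq_le_sq ?_ (Real.exp_pos _).le
    rw [← Real.exp_nat_mul]
    have : ‖1 - u‖ ^ 2 = 1 - 2 * u.re + ‖u‖ ^ 2 := by
      rw [Complex.sq_norm, Complex.sq_norm, Complex.normSq_apply, Complex.normSq_apply]
      simp
      ring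
    rw [this]
    refine le_trans ?_ (Real.add_one_le_exp _)
    push_cast
    linarith
  calc ‖1 - u‖ * Real.exp u.re ≤ Real.exp (-u.re + ‖u‖ ^ 2 / 2) * Real.exp u.re := by gcongr
    _ = _ := by rw [← Real.exp_add]; congr 1; ring

theorem prod_one_sub_eq_exp_mul_tprod (x : ℕ → ℂ) (m : ℕ) (hx : ∀ j, m ≤ j → x j = 0) (z : ℂ) :
    ∏ j ∈ Finset.range m, (1 - x j * z) =
      Complex.exp (-(∑ j ∈ Finset.range m, x j) * z - (∑ j ∈ Finset.range m, x j ^ 2) * z ^ 2 / 2) *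
        ∏' j, elemFactorTwo (x j * z) := by
  rw [tprod_eq_prod (s := Finset.range m) (fun j hj => by
    rw [hx j (by simpa using hj)]; simp [elemFactorTwo])]
  have h : ∀ j, (1 - x j * z) =
      Complex.exp (-(x j) * z - x j ^ 2 * z ^ 2 / 2) * elemFactorTwo (x j * z) := by
    intro j
    rw [elemFactorTwo, mul_left_comm, ← Complex.exp_add,
      show -(x j) * z - x j ^ 2 * z ^ 2 / 2 + (x j * z + (x j * z) ^ 2 / 2) = 0 by ring,
      Complex.exp_zero, mul_one]
  rw [Finset.prod_congr rfl fun j _ => h j, Finset.prod_mul_distrib, ← Complex.exp_sum,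
    Finset.sum_sub_distrib, ← Finset.sum_mul, ← Finset.sum_div, ← Finset.sum_mul,
    Finset.sum_neg_distrib]

theorem norm_prod_one_sub_le (x : ℕ → ℂ) (m : ℕ) (z : ℂ) :
    ‖∏ j ∈ Finset.range m, (1 - x j * z)‖ ≤
      Real.exp (‖∑ j ∈ Finset.range m, x j‖ * ‖z‖ +
        (∑ j ∈ Finset.range m, ‖x j‖ ^ 2) * ‖z‖ ^ 2 / 2) := by
  have h : ∀ j, (1 - x j * z) =
      Complex.exp (-(x j) * z) * ((1 - x j * z) * Complex.exp (x j * z)) := by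
    intro j
    rw [mul_left_comm, ← Complex.exp_add]
    simp
  rw [Finset.prod_congr rfl fun j _ => h j, Finset.prod_mul_distrib, ← Complex.exp_sum,
    norm_mul, Real.exp_add, ← Finset.sum_mul, Finset.sum_neg_distrib]
  gcongr
  · rw [Complex.norm_exp]
    gcongr
    refine (Complex.re_le_norm _).trans ?_
    rw [norm_mul, norm_neg]
  · rw [norm_prod, Finset.sum_mul, Finset.sum_div, Real.exp_sum]
    refine Finset.prod_le_prod (fun _ _ => norm_nonneg _) fun j _ => ?_
    refine (norm_one_sub_mul_exp_le _).trans_eq ?_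
    rw [norm_mul, mul_pow]

/-! ### Power sums and products in the half plane -/

theorem norm_sq_eq_two_mul_re_sq_sub (w : ℂ) : ‖w‖ ^ 2 = 2 * (w.re * w.re) - (w ^ 2).re := by
  rw [Complex.sq_norm, Complex.normSq_apply, sq w, Complex.mul_re]
  ring

theorem sum_norm_sq_le (x : ℕ → ℂ) (m : ℕ) (hre : ∀ j, 0 ≤ (x j).re) :
    ∑ j ∈ Finset.range m, ‖x j‖ ^ 2 ≤
      2 * ‖∑ j ∈ Finset.range m, x j‖ ^ 2 + ‖∑ j ∈ Finset.range m, x j ^ 2‖ := by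
  have h1 : ∑ j ∈ Finset.range m, (x j).re ^ 2 ≤ (∑ j ∈ Finset.range m, (x j).re) ^ 2 :=
    Finset.sum_sq_le_sq_sum_of_nonneg fun j _ => hre j
  have h2 : (∑ j ∈ Finset.range m, (x j).re) ^ 2 ≤ ‖∑ j ∈ Finset.range m, x j‖ ^ 2 := by
    rw [← Complex.re_sum]
    exact sq_le_sq' ((neg_le_neg (Complex.abs_re_le_norm _)).trans (neg_abs_le _))
      (Complex.re_le_norm _)
  have h3 : -(∑ j ∈ Finset.range m, x j ^ 2).re ≤ ‖∑ j ∈ Finset.range m, x j ^ 2‖ :=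
    (neg_le_abs _).trans (Complex.abs_re_le_norm _)
  simp only [norm_sq_eq_two_mul_re_sq_sub, ← sq, Finset.sum_sub_distrib, ← Finset.mul_sum,
    ← Complex.re_sum]
  simp only [norm_sq_eq_two_mul_re_sq_sub, ← sq] at h2 ⊢
  linarith

/-- The first `j + 1` entries have modulus at least `‖x j‖`, so `(j + 1) * ‖x j‖ ^ 2 ≤ C`. -/
theorem norm_le_sqrt_of_antitone (x : ℕ → ℂ) (m : ℕ) (hx : ∀ j, m ≤ j → x j = 0)
    (hanti : Antitone fun j => ‖x j‖) {C : ℝ} (hC : ∑ j ∈ Finset.range m, ‖x j‖ ^ 2 ≤ C) (j : ℕ) :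
    ‖x j‖ ≤ Real.sqrt (C / (j + 1)) := by
  refine Real.le_sqrt_of_sq_le ?_
  rw [le_div_iff₀ (by positivity)]
  have h1 : ∑ i ∈ Finset.range (j + 1), ‖x i‖ ^ 2 ≤ ∑ i ∈ Finset.range m, ‖x i‖ ^ 2 := by
    have hs : HasSum (fun i => ‖x i‖ ^ 2) (∑ i ∈ Finset.range m, ‖x i‖ ^ 2) :=
      hasSum_sum_of_ne_finset_zero fun i hi => by simp [hx i (by simpa using hi)]
    exact sum_le_hasSum _ (fun i _ => by positivity) hs
  have h2 : ∑ i ∈ Finset.range (j + 1), ‖x j‖ ^ 2 ≤ ∑ i ∈ Finset.range (j + 1), ‖x i‖ ^ 2 :=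
    Finset.sum_le_sum fun i hi => by
      gcongr
      exact hanti (Nat.lt_succ_iff.1 (Finset.mem_range.1 hi))
  rw [Finset.sum_const, Finset.card_range, nsmul_eq_mul] at h2
  push_cast at h2
  linarith

section Limit

variable {x : ℕ → ℕ → ℂ} {m : ℕ → ℕ} {y : ℕ → ℂ} {b : ℕ → ℝ} {s₁ s₂ : ℂ}

/-- Limits of the first two power sums of finite families in the closed right half plane: the first
may lose real mass, the second only nonpositive real mass. -/
theorem power_sums_of_tendsto (hx : ∀ n j, m n ≤ j → x n j = 0) (hre : ∀ n j, 0 ≤ (x n j).re)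
    (hxb : ∀ n j, ‖x n j‖ ≤ b j) (hb : Tendsto b atTop (𝓝 0))
    (hy : ∀ j, Tendsto (fun n => x n j) atTop (𝓝 (y j)))
    (h₁ : Tendsto (fun n => ∑ j ∈ Finset.range (m n), x n j) atTop (𝓝 s₁))
    (h₂ : Tendsto (fun n => ∑ j ∈ Finset.range (m n), x n j ^ 2) atTop (𝓝 s₂)) :
    (Summable fun j => ‖y j‖ ^ 2) ∧ (Summable fun j => (y j).re) ∧ ∑' j, (y j).re ≤ s₁.re ∧
      ∃ α : ℝ, 0 ≤ α ∧ ∑' j, y j ^ 2 - s₂ = 2 * α := by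
  have hfin : ∀ (φ : ℂ → ℝ), φ 0 = 0 → ∀ n, HasSum (fun j => φ (x n j))
      (∑ j ∈ Finset.range (m n), φ (x n j)) := fun φ hφ n =>
    hasSum_sum_of_ne_finset_zero fun j hj => by rw [hx n j (by simpa using hj), hφ]
  have hyre : ∀ j, Tendsto (fun n => (x n j).re) atTop (𝓝 (y j).re) := fun j =>
    (Complex.continuous_re.tendsto _).comp (hy j)
  have hyim : ∀ j, Tendsto (fun n => (x n j).im) atTop (𝓝 (y j).im) := fun j =>
    (Complex.continuous_im.tendsto _).comp (hy j)
  have hsre : ∀ n, Summable fun j => (x n j).re := fun n => (hfin _ Complex.zero_re n).summable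
  have h₁re : Tendsto (fun n => ∑' j, (x n j).re) atTop (𝓝 s₁.re) := by
    refine ((Complex.continuous_re.tendsto _).comp h₁).congr fun n => ?_
    rw [(hfin _ Complex.zero_re n).tsum_eq, Function.comp, Complex.re_sum]
  obtain ⟨hyreS, hyreL⟩ := summable_and_tsum_le_of_tendsto hre hsre h₁re hyre
  obtain ⟨M, hM⟩ := h₁re.bddAbove_range
  have hM : ∀ n, ∑' j, (x n j).re ≤ M := fun n => hM ⟨n, rfl⟩
  have hM' : ∑' j, (y j).re ≤ M := hyreL.trans (le_of_tendsto' h₁re hM)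
  have hA : Tendsto (fun n => ∑' j, (x n j).re * (x n j).re) atTop
      (𝓝 (∑' j, (y j).re * (y j).re)) :=
    tendsto_tsum_mul_of_bounded_of_tendsto_zero hre hsre hM
      (fun n j => (Complex.abs_re_le_norm _).trans (hxb n j)) hb hyreS hM' hyre hyre
  have hI : Tendsto (fun n => ∑' j, (x n j).re * (x n j).im) atTop
      (𝓝 (∑' j, (y j).re * (y j).im)) :=
    tendsto_tsum_mul_of_bounded_of_tendsto_zero hre hsre hM
      (fun n j => (Complex.abs_im_le_norm _).trans (hxb n j)) hb hyreS hM' hyre hyim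
  -- The sums of `(Re x)²` converge without loss, so the limit of `∑ |x|²` is known; Fatou then
  -- compares it with `∑ |y|²`, giving `Re s₂ ≤ Re ∑ y²`.
  have hN : Tendsto (fun n => ∑' j, ‖x n j‖ ^ 2) atTop
      (𝓝 (2 * ∑' j, (y j).re * (y j).re - s₂.re)) := by
    refine ((hA.const_mul 2).sub ((Complex.continuous_re.tendsto _).comp h₂)).congr fun n => ?_
    simp only [norm_sq_eq_two_mul_re_sq_sub]
    rw [Function.comp, Complex.re_sum]
    exact ((((hfin (fun w => w.re * w.re) (by simp) n).summable.hasSum.mul_left 2).sub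
      (hfin (fun w => (w ^ 2).re) (by simp) n)).tsum_eq).symm
  obtain ⟨hyN, hyNL⟩ := summable_and_tsum_le_of_tendsto (a := fun n j => ‖x n j‖ ^ 2)
    (a' := fun j => ‖y j‖ ^ 2) (fun n j => by positivity)
    (fun n => (hfin (fun w => ‖w‖ ^ 2) (by simp) n).summable) hN (fun j => (hy j).norm.pow 2)
  have hysq : Summable fun j => y j ^ 2 := Summable.of_norm (by simpa only [norm_pow] using hyN)
  refine ⟨hyN, hyreS, hyreL, (∑' j, y j ^ 2 - s₂).re / 2, ?_, ?_⟩
  · have hyrr : Summable fun j => (y j).re * (y j).re :=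
      Summable.of_nonneg_of_le (fun j => mul_self_nonneg _) (fun j => by
        rw [Complex.sq_norm, Complex.normSq_apply]
        linarith [mul_self_nonneg (y j).im]) hyN
    have h3 : ∑' j, ‖y j‖ ^ 2 = 2 * ∑' j, (y j).re * (y j).re - (∑' j, y j ^ 2).re := by
      simp only [norm_sq_eq_two_mul_re_sq_sub]
      exact ((hyrr.hasSum.mul_left 2).sub (Complex.hasSum_re hysq.hasSum)).tsum_eq
    rw [Complex.sub_re]
    linarith
  -- `Im (w²) = 2 Re w Im w`, and these sums lose nothing in the limit.
  · have him : (∑' j, y j ^ 2 - s₂).im = 0 := by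
      have hw : ∀ w : ℂ, (w ^ 2).im = 2 * (w.re * w.im) := fun w => by
        rw [sq, Complex.mul_im]; ring
      have h4 : Tendsto (fun n => (∑ j ∈ Finset.range (m n), x n j ^ 2).im) atTop
          (𝓝 (2 * ∑' j, (y j).re * (y j).im)) := by
        refine (hI.const_mul 2).congr fun n => ?_
        rw [(hfin (fun w => w.re * w.im) (by simp) n).tsum_eq, Complex.im_sum, Finset.mul_sum]
        simp only [hw]
      have h5 := tendsto_nhds_unique h4 ((Complex.continuous_im.tendsto _).comp h₂)
      rw [Complex.sub_im, ← h5, Complex.im_tsum hysq]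
      simp only [hw, tsum_mul_left, sub_self]
    apply Complex.ext
    · simp only [Complex.mul_re, Complex.re_ofNat, Complex.ofReal_re, Complex.im_ofNat, zero_mul,
        sub_zero]
      ring
    · simpa using him

theorem summable_sqrt_div_pow_three (C : ℝ) :
    Summable fun j : ℕ => Real.sqrt (C / (j + 1)) ^ 3 := by
  rcases le_or_gt C 0 with hC | hC
  · refine summable_zero.congr fun j => ?_
    rw [Real.sqrt_eq_zero_of_nonpos (div_nonpos_of_nonpos_of_nonneg hC (by positivity))]
    simp
  have h1 : Summable fun j : ℕ => 1 / ((j + 1 : ℕ) : ℝ) ^ (3 / 2 : ℝ) :=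
    (summable_nat_add_iff 1).2 (Real.summable_one_div_nat_rpow.2 (by norm_num))
  refine (h1.mul_left (C ^ (3 / 2 : ℝ))).congr fun j => ?_
  rw [Real.sqrt_eq_rpow, ← Real.rpow_natCast, ← Real.rpow_mul (by positivity),
    Real.div_rpow hC.le (by positivity)]
  push_cast
  rw [mul_one_div]
  norm_num

theorem tendsto_tprod_elemFactorTwo {C : ℝ} (hxb : ∀ n j, ‖x n j‖ ≤ Real.sqrt (C / (j + 1)))
    (hy : ∀ j, Tendsto (fun n => x n j) atTop (𝓝 (y j))) (z : ℂ) :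
    (Multipliable fun j => elemFactorTwo (y j * z)) ∧
      Tendsto (fun n => ∏' j, elemFactorTwo (x n j * z)) atTop
        (𝓝 (∏' j, elemFactorTwo (y j * z))) := by
  have hC : ∀ j : ℕ, Real.sqrt (C / (j + 1)) ≤ Real.sqrt |C| := fun j => by
    refine Real.sqrt_le_sqrt ((div_le_div_of_nonneg_right (le_abs_self C) (by positivity)).trans ?_)
    exact div_le_self (abs_nonneg C) (by linarith [Nat.cast_nonneg (α := ℝ) j])
  set R := Real.sqrt |C| * ‖z‖ with hR
  have key : ∀ (j : ℕ) (w : ℂ), ‖w‖ ≤ Real.sqrt (C / (j + 1)) → ‖elemFactorTwo (w * z) - 1‖ ≤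
      Real.exp (R + R ^ 2 / 2) * ‖z‖ ^ 3 * Real.sqrt (C / (j + 1)) ^ 3 := by
    intro j w hw
    have h1 : ‖w * z‖ ≤ R := by
      rw [norm_mul, hR]
      gcongr
      exact hw.trans (hC j)
    refine (norm_elemFactorTwo_sub_one_le h1).trans ?_
    rw [norm_mul, mul_pow ‖w‖, mul_comm (‖w‖ ^ 3), ← mul_assoc]
    gcongr
  have hbs := (summable_sqrt_div_pow_three C).mul_left (Real.exp (R + R ^ 2 / 2) * ‖z‖ ^ 3)
  have hyb : ∀ j, ‖y j‖ ≤ Real.sqrt (C / (j + 1)) := fun j =>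
    le_of_tendsto' (hy j).norm fun n => hxb n j
  have hcont : Continuous elemFactorTwo := by unfold elemFactorTwo; fun_prop
  constructor
  · have h := multipliable_one_add_of_summable (f := fun j => elemFactorTwo (y j * z) - 1)
      (Summable.of_nonneg_of_le (fun j => norm_nonneg _) (fun j => key j _ (hyb j)) hbs)
    simpa using h
  · have h := tendsto_tprod_one_add_of_dominated_convergence (𝓕 := atTop)
      (f := fun n j => elemFactorTwo (x n j * z) - 1) (g := fun j => elemFactorTwo (y j * z) - 1)
      hbs (fun j => ((hcont.tendsto _).comp ((hy j).mul_const z)).sub_const 1)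
      (Eventually.of_forall fun n j => key j _ (hxb n j))
    simpa using h

end Limit

/-- Because `∑ y²` converges, the quadratic exponents can be summed separately, turning genus two
into genus one. -/
theorem hasProd_one_sub_mul_exp {y : ℕ → ℂ} (z : ℂ) (hy : Summable fun j => ‖y j‖ ^ 2)
    (h : Multipliable fun j => elemFactorTwo (y j * z)) :
    HasProd (fun j => (1 - y j * z) * Complex.exp (y j * z))
      ((∏' j, elemFactorTwo (y j * z)) * Complex.exp (-(∑' j, y j ^ 2) * z ^ 2 / 2)) := by
  have hysq : Summable fun j => y j ^ 2 := Summable.of_norm (by simpa only [norm_pow] using hy)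
  have h1 : HasSum (fun j => -(y j ^ 2) * z ^ 2 / 2) (-(∑' j, y j ^ 2) * z ^ 2 / 2) :=
    (hysq.hasSum.neg.mul_right _).div_const _
  refine (h.hasProd.mul h1.cexp).congr_fun fun j => ?_
  rw [Function.comp, elemFactorTwo, mul_assoc, ← Complex.exp_add]
  congr 2
  ring

/-! ### Compactness and assembly of the limit -/

/-- A bounded array with `‖x n j‖ ≤ b j` has a subsequence of rows converging entrywise. -/
theorem exists_subseq_tendsto_entrywise {x : ℕ → ℕ → ℂ} {b : ℕ → ℝ} (hxb : ∀ n j, ‖x n j‖ ≤ b j) :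
    ∃ (y : ℕ → ℂ) (φ : ℕ → ℕ), StrictMono φ ∧
      ∀ j, Tendsto (fun n => x (φ n) j) atTop (𝓝 (y j)) := by
  have hK : IsCompact (Set.univ.pi fun j => Metric.closedBall (0 : ℂ) (b j)) :=
    isCompact_univ_pi fun j => isCompact_closedBall _ _
  obtain ⟨y, -, φ, hφ, hy⟩ := hK.tendsto_subseq (x := x) fun n j _ => by simpa using hxb n j
  exact ⟨y, φ, hφ, fun j => (tendsto_pi_nhds.1 hy) j⟩

theorem tendsto_coeff_of_weaklyConvergent {f : ℕ → Polynomial ℂ} (hf : WeaklyConvergent f)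
    (k : ℕ) : ∃ c : ℂ, Tendsto (fun n => (f n).coeff k) atTop (𝓝 c) := by
  obtain ⟨c, hc⟩ := hf k
  have hk : (k.factorial : ℂ) ≠ 0 := Nat.cast_ne_zero.2 k.factorial_ne_zero
  refine ⟨c / k.factorial, (hc.div_const _).congr fun n => ?_⟩
  rw [← Polynomial.coeff_zero_eq_eval_zero, Polynomial.coeff_iterate_derivative, zero_add,
    Nat.descFactorial_self, nsmul_eq_mul, mul_div_cancel_left₀ _ hk]

/-- Reindexing an infinite product over reciprocal zeros by its nonzero entries. -/
theorem hasProd_subtype_inv {y : ℕ → ℂ} {z P : ℂ}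
    (h : HasProd (fun j => (1 - y j * z) * Complex.exp (y j * z)) P) :
    HasProd (fun j : {j // y j ≠ 0} => (1 - z / (y j)⁻¹) * Complex.exp (z / (y j)⁻¹)) P := by
  have hs : Function.mulSupport (fun j => (1 - y j * z) * Complex.exp (y j * z)) ⊆
      {j | y j ≠ 0} := by
    intro j hj h0
    exact hj (by simp [h0])
  refine ((hasProd_subtype_iff_of_mulSupport_subset hs).2 h).congr_fun fun j => ?_
  simp only [div_inv_eq_mul, Function.comp, mul_comm z]

/-- The bound holds along the whole sequence; a subsequence suffices for the product formula since
the pointwise limit `g` is given. -/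
theorem bounded_and_factorization {f : ℕ → Polynomial ℂ} {c : ℕ → ℂ}
    (hc : ∀ k, Tendsto (fun n => (f n).coeff k) atTop (𝓝 (c k))) (hc0 : c 0 ≠ 0)
    (h0 : ∀ n, (f n).eval 0 ≠ 0) (hzero : ∀ n, zeroSet (f n) ⊆ rightHalfPlane) :
    (∀ R : ℝ, ∃ B : ℝ, ∀ n, ∀ z : ℂ, ‖z‖ ≤ R → ‖(f n).eval z‖ ≤ B) ∧
    ∀ g : ℂ → ℂ, (∀ z, Tendsto (fun n => (f n).eval z) atTop (𝓝 (g z))) →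
      ∃ (α : ℝ) (β : ℂ) (ι : Type) (_ : Countable ι) (a : ι → ℂ),
        (∀ j, a j ∈ rightHalfPlane \ {0}) ∧
        Summable (fun j => (‖a j‖ ^ 2)⁻¹) ∧
        (∀ z : ℂ, Multipliable (fun j => (1 - z / a j) * Complex.exp (z / a j)) ∧
          g z = g 0 * Complex.exp ((α : ℂ) * z ^ 2 - β * z) *
            ∏' j, (1 - z / a j) * Complex.exp (z / a j)) ∧
        Summable (fun j => ((a j)⁻¹).re) ∧
        ∑' j, ((a j)⁻¹).re ≤ β.re ∧
        0 ≤ α := by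
  choose x m hx hanti hre hf using fun n => exists_antitone_factorization (f n) (h0 n) (hzero n)
  have heval : ∀ n z, (f n).eval z =
      (f n).eval 0 * ∏ j ∈ Finset.range (m n), (1 - x n j * z) := by
    intro n z
    conv_lhs => rw [hf n]
    simp [Polynomial.eval_prod]
  have hcoeff : ∀ n k, (f n).coeff k = (f n).eval 0 *
      (∏ j ∈ Finset.range (m n), (1 - Polynomial.C (x n j) * Polynomial.X)).coeff k := by
    intro n k
    conv_lhs => rw [hf n]
    rw [Polynomial.coeff_C_mul]
  have hev0 : Tendsto (fun n => (f n).eval 0) atTop (𝓝 (c 0)) :=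
    (hc 0).congr fun n => Polynomial.coeff_zero_eq_eval_zero _
  have h₁ : Tendsto (fun n => ∑ j ∈ Finset.range (m n), x n j) atTop (𝓝 (-(c 1 / c 0))) := by
    refine (((hc 1).div hev0 hc0).neg).congr fun n => ?_
    rw [Pi.div_apply, hcoeff n 1, mul_div_cancel_left₀ _ (h0 n), coeff_one_prod_one_sub, neg_neg]
  have h₂ : Tendsto (fun n => ∑ j ∈ Finset.range (m n), x n j ^ 2) atTop
      (𝓝 ((-(c 1 / c 0)) ^ 2 - 2 * (c 2 / c 0))) := by
    refine ((h₁.pow 2).sub (((hc 2).div hev0 hc0).const_mul 2)).congr fun n => ?_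
    rw [Pi.div_apply, hcoeff n 2, mul_div_cancel_left₀ _ (h0 n), coeff_two_prod_one_sub,
      sub_sub_cancel]
  generalize -(c 1 / c 0) = s₁ at h₁ h₂
  generalize s₁ ^ 2 - 2 * (c 2 / c 0) = s₂ at h₂
  obtain ⟨M₀, hM₀⟩ := hev0.norm.bddAbove_range
  obtain ⟨M₁, hM₁⟩ := h₁.norm.bddAbove_range
  obtain ⟨M₂, hM₂⟩ := h₂.norm.bddAbove_range
  have hM₀ : ∀ n, ‖(f n).eval 0‖ ≤ M₀ := fun n => hM₀ ⟨n, rfl⟩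
  have hM₁ : ∀ n, ‖∑ j ∈ Finset.range (m n), x n j‖ ≤ M₁ := fun n => hM₁ ⟨n, rfl⟩
  have hM₂ : ∀ n, ‖∑ j ∈ Finset.range (m n), x n j ^ 2‖ ≤ M₂ := fun n => hM₂ ⟨n, rfl⟩
  have hC : ∀ n, ∑ j ∈ Finset.range (m n), ‖x n j‖ ^ 2 ≤ 2 * M₁ ^ 2 + M₂ := fun n => by
    refine (sum_norm_sq_le _ _ (hre n)).trans ?_
    have := hM₁ n
    have := hM₂ n
    gcongr
  generalize 2 * M₁ ^ 2 + M₂ = C at hC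
  have hxb : ∀ n j, ‖x n j‖ ≤ Real.sqrt (C / (j + 1)) := fun n =>
    norm_le_sqrt_of_antitone _ _ (hx n) (hanti n) (hC n)
  have hM₀0 : 0 ≤ M₀ := (norm_nonneg _).trans (hM₀ 0)
  have hM₁0 : 0 ≤ M₁ := (norm_nonneg _).trans (hM₁ 0)
  have hC0 : 0 ≤ C := (Finset.sum_nonneg fun _ _ => by positivity).trans (hC 0)
  refine ⟨fun R => ⟨M₀ * Real.exp (M₁ * R + C * R ^ 2 / 2), fun n z hz => ?_⟩, fun g hg => ?_⟩
  · rw [heval, norm_mul]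
    refine mul_le_mul (hM₀ n) ((norm_prod_one_sub_le _ _ _).trans ?_) (norm_nonneg _) hM₀0
    gcongr
    · exact hM₁ n
    · exact hC n
  · obtain ⟨y, φ, hφ, hy⟩ := exists_subseq_tendsto_entrywise hxb
    have hb : Tendsto (fun j : ℕ => Real.sqrt (C / (j + 1))) atTop (𝓝 0) := by
      have : Tendsto (fun j : ℕ => C / ((j : ℝ) + 1)) atTop (𝓝 0) :=
        tendsto_const_nhds.div_atTop
          (tendsto_atTop_add_const_right _ 1 tendsto_natCast_atTop_atTop)
      simpa using this.sqrt
    obtain ⟨hy2, hyre, hyle, α, hα, hαe⟩ := power_sums_of_tendsto (x := fun n => x (φ n))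
      (fun n => hx (φ n)) (fun n => hre (φ n)) (fun n => hxb (φ n)) hb hy
      (h₁.comp hφ.tendsto_atTop) (h₂.comp hφ.tendsto_atTop)
    have hyre0 : ∀ j, 0 ≤ (y j).re := fun j =>
      ge_of_tendsto' ((Complex.continuous_re.tendsto _).comp (hy j)) fun n => hre (φ n) j
    have hgz : ∀ z, HasProd (fun j => (1 - y j * z) * Complex.exp (y j * z))
          ((∏' j, elemFactorTwo (y j * z)) * Complex.exp (-(∑' j, y j ^ 2) * z ^ 2 / 2)) ∧
        g z = g 0 * Complex.exp ((α : ℂ) * z ^ 2 - s₁ * z) *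
          ((∏' j, elemFactorTwo (y j * z)) * Complex.exp (-(∑' j, y j ^ 2) * z ^ 2 / 2)) := by
      intro z
      obtain ⟨hmul, hlim⟩ := tendsto_tprod_elemFactorTwo (x := fun n => x (φ n))
        (fun n => hxb (φ n)) hy z
      refine ⟨hasProd_one_sub_mul_exp z hy2 hmul, ?_⟩
      have h3 : Tendsto (fun n => (f (φ n)).eval z) atTop
          (𝓝 (g 0 * (Complex.exp (-s₁ * z - s₂ * z ^ 2 / 2) *
            ∏' j, elemFactorTwo (y j * z)))) := by
        refine (((hg 0).comp hφ.tendsto_atTop).mul (Tendsto.mul ((((((h₁.comp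
          hφ.tendsto_atTop).neg).mul_const z).sub (((h₂.comp hφ.tendsto_atTop).mul_const
          (z ^ 2)).div_const 2))).cexp) hlim)).congr fun n => ?_
        rw [heval (φ n) z, prod_one_sub_eq_exp_mul_tprod _ _ (hx (φ n))]
        rfl
      rw [tendsto_nhds_unique ((hg z).comp hφ.tendsto_atTop) h3, mul_assoc,
        mul_comm (∏' j, _) (Complex.exp _), ← mul_assoc (Complex.exp _) (Complex.exp _),
        ← Complex.exp_add]
      congr 3
      linear_combination (z ^ 2 / 2) * hαe
    -- Entries with `y j = 0` correspond to no zero and contribute factors 1, so they are dropped.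
    refine ⟨α, s₁, {j // y j ≠ 0}, inferInstance, fun j => (y j)⁻¹, fun j => ⟨?_, ?_⟩, ?_, ?_,
      ?_, ?_, hα⟩
    · change 0 ≤ ((y j)⁻¹).re
      rw [Complex.inv_re]
      exact div_nonneg (hyre0 j) (Complex.normSq_nonneg _)
    · exact inv_ne_zero j.2
    · simpa only [norm_inv, inv_pow, inv_inv] using! hy2.subtype {j | y j ≠ 0}
    · intro z
      have h4 := hasProd_subtype_inv (hgz z).1
      exact ⟨h4.multipliable, by rw [h4.tprod_eq]; exact (hgz z).2⟩
    · simpa only [inv_inv] using! hyre.subtype {j | y j ≠ 0}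
    · refine le_of_eq_of_le ?_ hyle
      simp only [inv_inv]
      exact tsum_subtype_eq_of_support_subset (f := fun j => (y j).re) (s := {j | y j ≠ 0})
        fun j hj h0 => hj (by simp [h0])

end PolySeq

theorem theorem2p5 (f : ℕ → Polynomial ℂ)
    (hweak : PolySeq.WeaklyConvergent f)
    (h0 : ∃ L : ℂ, L ≠ 0 ∧ Tendsto (fun n => (f n).eval 0) atTop (𝓝 L))
    (hzero : ∀ n, PolySeq.zeroSet (f n) ⊆ PolySeq.rightHalfPlane) :
    ∃ g : ℂ → ℂ, Differentiable ℂ g ∧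
      PolySeq.StronglyConvergesTo (fun n z => (f n).eval z) g ∧
      ∃ (α : ℝ) (β : ℂ) (ι : Type) (_ : Countable ι) (a : ι → ℂ),
        (∀ j, a j ∈ PolySeq.rightHalfPlane \ {0}) ∧
        Summable (fun j => (‖a j‖ ^ 2)⁻¹) ∧
        (∀ z : ℂ, Multipliable (fun j => (1 - z / a j) * Complex.exp (z / a j)) ∧
          g z = g 0 * Complex.exp ((α : ℂ) * z ^ 2 - β * z) *
            ∏' j, (1 - z / a j) * Complex.exp (z / a j)) ∧
        Summable (fun j => ((a j)⁻¹).re) ∧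
        ∑' j, ((a j)⁻¹).re ≤ β.re ∧
        0 ≤ α := by
  choose c hc using PolySeq.tendsto_coeff_of_weaklyConvergent hweak
  obtain ⟨L, hL0, hL⟩ := h0
  have hc0 : c 0 ≠ 0 := by
    have : c 0 = L := tendsto_nhds_unique (hc 0)
      (hL.congr fun n => (Polynomial.coeff_zero_eq_eval_zero _).symm)
    rwa [this]
  -- Finitely many `f n` may vanish at `0`; shifting by `N` discards them.
  obtain ⟨N, hN⟩ := eventually_atTop.1 (hL.eventually_ne hL0)
  obtain ⟨hbdd, hfact⟩ := PolySeq.bounded_and_factorization (f := fun n => f (n + N))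
    (fun k => (hc k).comp (tendsto_add_atTop_nat N)) hc0 (fun n => hN _ (Nat.le_add_left _ _))
    (fun n => hzero _)
  obtain ⟨g, hg, hfg⟩ := PolySeq.exists_stronglyConvergesTo f c hc fun R => by
    obtain ⟨B, hB⟩ := hbdd R
    refine ⟨B, eventually_atTop.2 ⟨N, fun n hn => ?_⟩⟩
    have := hB (n - N)
    simpa only [Nat.sub_add_cancel hn] using! this
  exact ⟨g, hg, hfg, hfact g fun z =>
    ((hfg {z} isCompact_singleton).tendsto_at rfl).comp (tendsto_add_atTop_nat N)⟩
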